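/- Let $A$, $B$ be quantum systems with finite-dimensional Hilbert spaces $\mathcal H_A,\mathcal H_B$, and $\mathcal H_{AB}=\mathcal H_A\otimes\mathcal H_B$. A normalized state is a positive semi-definite operator of trace $1$; a sub-normalized state is a positive semi-definite operator with trace in $(0,1]$. For sub-normalized $\rho,\tau$ put $$\bar F(\rho,\tau)=\operatorname{tr}\bigl|\sqrt\rho\sqrt\tau\bigr|+\sqrt{(1-\operatorname{tr}\rho)(1-\operatorname{tr}\tau)},\qquad P(\rho,\tau)=\sqrt{1-\bar F(\rho,\tau)^2},$$ and let $\mathcal B^{\varepsilon}(\rho)$ be the set of sub-normalized $\tilde\rho$ on the same space with $P(\rho,\tilde\rho)\le\varepsilon$. For positive semi-definite operators let $D_{\max}(\rho\|\tau)=\inf\{\lambda\in\mathbb R:\rho\le 2^{\lambda}\tau\}$ (with $\inf\emptyset=+\infty$). All entropies take values in $[-\infty,+\infty]$ and logarithms are to base $2$. Define $$H_{\min}(A|B)_\rho=\sup_{\sigma_B}-D_{\max}(\rho_{AB}\|\mathbb 1_A\otimes\sigma_B),\qquad \hat H_{\min}(A|B)_\rho=-D_{\max}(\rho_{AB}\|\mathbb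 1_A\otimes\rho_B),$$ where the supremum is over normalized states $\sigma_B$ and $\rho_B=\operatorname{tr}_A\rho_{AB}$. For $\varepsilon\ge0$ define the smooth and the alternative smooth min-entropy $$H^{\varepsilon}_{\min}(A|B)_\rho=\sup_{\tilde\rho_{AB}\in\mathcal B^\varepsilon(\rho_{AB})}H_{\min}(A|B)_{\tilde\rho},\qquad \hat H^{\varepsilon}_{\min}(A|B)_\rho=\sup_{\tilde\rho_{AB}\in\mathcal B^\varepsilon(\rho_{AB})}\hat H_{\min}(A|B)_{\tilde\rho},$$ and the corresponding max-entropies $H^{\varepsilon}_{\max}(A|B)_\rho=-H^{\varepsilon}_{\min}(A|C)_\rho$ and $\hat H^{\varepsilon}_{\max}(A|B)_\rho=-\hat H^{\varepsilon}_{\min}(A|C)_\rho$, where $\rho_{ABC}$ is a purification of $\rho_{AB}$ with finite-dimensional $\mathcal H_C$. Let $\varepsilon>0$, $0\le\varepsilon'<1$, let $\rho_{AB}$ be a normalized state, and let $c=\frac{2}{\varepsilon^2}+\frac1{1-\varepsilon'}$. Then $$H^{\varepsilon'}_{\min}(A|B)_\rho-\log c\ \le\ \hat H^{\varepsilon+\varepsilon'}_{\min}(A|B)_\rho\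 \le\ H^{\varepsilon+\varepsilon'}_{\min}(A|B)_\rho .$$ Moreover, the max-entropies, evaluated on the standard purification (the vector $\sum_x (\sqrt{\rho_{AB}}\otimes\mathbb 1)\,|x\rangle\otimes|x\rangle$, with $|x\rangle$ a product orthonormal basis of $\mathcal H_{AB}$ and $\mathcal H_C$ a copy of $\mathcal H_{AB}$) or on any other purification $\rho_{ABC}$ of $\rho_{AB}$, satisfy $$H^{\varepsilon'}_{\max}(A|B)_\rho+\log c\ \ge\ \hat H^{\varepsilon+\varepsilon'}_{\max}(A|B)_\rho\ \ge\ H^{\varepsilon+\varepsilon'}_{\max}(A|B)_\rho .$$ -/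

import Mathlib

open scoped MatrixOrder ComplexOrder Kronecker Matrix

noncomputable section

namespace QuantumEntropy

variable {A B C H : Type*} [Fintype A] [Fintype B] [Fintype C] [Fintype H]
  [DecidableEq A] [DecidableEq B] [DecidableEq C] [DecidableEq H]

/-! Operators on the finite-dimensional Hilbert space with orthonormal basis indexed by `H` are
matrices over `H`; the tensor product of two spaces has basis `A × B`. The order `≤` is the
Loewner order, and `CFC.abs X` is the positive square root of `Xᴴ * X`. -/

/-- Normalized states. -/
def IsNormalized (ρ : Matrix H H ℂ) : Prop :=
  ρ.PosSemidef ∧ ρ.trace = 1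

/-- Sub-normalized states: positive semi-definite with trace in `(0, 1]`. -/
def IsSubnormalized (ρ : Matrix H H ℂ) : Prop :=
  ρ.PosSemidef ∧ 0 < ρ.trace.re ∧ ρ.trace.re ≤ 1

/-- Generalized fidelity `tr |√ρ √τ| + √((1 - tr ρ) (1 - tr τ))`. -/
def genFidelity (ρ τ : Matrix H H ℂ) : ℝ :=
  (CFC.abs (CFC.sqrt ρ * CFC.sqrt τ)).trace.re +
    Real.sqrt ((1 - ρ.trace.re) * (1 - τ.trace.re))

/-- Purified distance. -/
def purifiedDist (ρ τ : Matrix H H ℂ) : ℝ :=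
  Real.sqrt (1 - genFidelity ρ τ ^ 2)

/-- The `ε`-ball of sub-normalized states around `ρ`. -/
def epsBall (ε : ℝ) (ρ : Matrix H H ℂ) : Set (Matrix H H ℂ) :=
  {τ | IsSubnormalized τ ∧ purifiedDist ρ τ ≤ ε}

/-- Partial trace over the first factor. -/
def traceFst (ρ : Matrix (A × B) (A × B) ℂ) : Matrix B B ℂ :=
  Matrix.of fun b b' => ∑ a, ρ (a, b) (a, b')

/-- Partial trace over the second factor. -/
def traceSnd (ρ : Matrix (A × B) (A × B) ℂ) : Matrix A A ℂ :=
  Matrix.of fun a a' => ∑ b, ρ (a, b) (a', b)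

/-- Partial trace over the middle factor of a tripartite space. -/
def traceMid (ρ : Matrix ((A × B) × C) ((A × B) × C) ℂ) : Matrix (A × C) (A × C) ℂ :=
  Matrix.of fun x y => ∑ b, ρ ((x.1, b), x.2) ((y.1, b), y.2)

/-- Max relative entropy `inf {l : ρ ≤ 2 ^ l τ}`, with value `⊤` if no such `l` exists. -/
def Dmax (ρ τ : Matrix H H ℂ) : EReal :=
  sInf ((fun l : ℝ => (l : EReal)) '' {l : ℝ | ρ ≤ ((2 : ℝ) ^ l) • τ})

/-- Conditional min-entropy of the first system given the second. -/
def minEntropy (ρ : Matrix (A × B) (A × B) ℂ) : EReal :=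
  ⨆ σ ∈ {σ : Matrix B B ℂ | IsNormalized σ}, -Dmax ρ ((1 : Matrix A A ℂ) ⊗ₖ σ)

/-- Alternative conditional min-entropy, relative to the marginal on the second system. -/
def altMinEntropy (ρ : Matrix (A × B) (A × B) ℂ) : EReal :=
  -Dmax ρ ((1 : Matrix A A ℂ) ⊗ₖ traceFst ρ)

/-- Smooth conditional min-entropy. -/
def smoothMinEntropy (ε : ℝ) (ρ : Matrix (A × B) (A × B) ℂ) : EReal :=
  ⨆ τ ∈ epsBall ε ρ, minEntropy τ

/-- Alternative smooth conditional min-entropy. -/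
def altSmoothMinEntropy (ε : ℝ) (ρ : Matrix (A × B) (A × B) ℂ) : EReal :=
  ⨆ τ ∈ epsBall ε ρ, altMinEntropy τ

/-- The operator `|ψ⟩⟨ψ|`. -/
def proj (ψ : H → ℂ) : Matrix H H ℂ :=
  Matrix.vecMulVec ψ (star ψ)

/-- The vector `ψ` of the space `ABC` is a purification of the state `ρ` of `AB`. -/
def IsPurification (ψ : (A × B) × C → ℂ) (ρ : Matrix (A × B) (A × B) ℂ) : Prop :=
  traceSnd (proj ψ) = ρ

/-- The standard purification, on a purifying system that is a copy of `AB`. -/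
def stdPurification (ρ : Matrix (A × B) (A × B) ℂ) : (A × B) × (A × B) → ℂ :=
  fun x => CFC.sqrt ρ x.1 x.2

theorem stdPurification_isPurification {ρ : Matrix (A × B) (A × B) ℂ} (h : ρ.PosSemidef) :
    IsPurification (stdPurification ρ) ρ := by
  have hs : (CFC.sqrt ρ)ᴴ = CFC.sqrt ρ :=
    (IsSelfAdjoint.of_nonneg (CFC.sqrt_nonneg ρ)).star_eq
  have h2 : CFC.sqrt ρ * (CFC.sqrt ρ)ᴴ = ρ := by
    rw [hs]; exact CFC.sqrt_mul_sqrt_self ρ h.nonneg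
  unfold IsPurification
  conv_rhs => rw [← h2]
  ext x y
  simp [traceSnd, proj, stdPurification, Matrix.vecMulVec_apply, Matrix.mul_apply]

/-- Smooth max-entropy of `A` given `B` evaluated on a pure state `ψ` of `ABC`: the dual
`-H_min(A|C)` of the smooth min-entropy. -/
def smoothMaxEntropyOf (ε : ℝ) (ψ : (A × B) × C → ℂ) : EReal :=
  -smoothMinEntropy ε (traceMid (proj ψ))

/-- Alternative smooth max-entropy of `A` given `B` evaluated on a pure state `ψ` of `ABC`. -/
def altSmoothMaxEntropyOf (ε : ℝ) (ψ : (A × B) × C → ℂ) : EReal :=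
  -altSmoothMinEntropy ε (traceMid (proj ψ))

/-- Smooth max-entropy of `A` given `B` of the state `ρ` of `AB`. -/
def smoothMaxEntropy (ε : ℝ) (ρ : Matrix (A × B) (A × B) ℂ) : EReal :=
  smoothMaxEntropyOf ε (stdPurification ρ)

/-- Alternative smooth max-entropy of `A` given `B` of the state `ρ` of `AB`. -/
def altSmoothMaxEntropy (ε : ℝ) (ρ : Matrix (A × B) (A × B) ℂ) : EReal :=
  altSmoothMaxEntropyOf ε (stdPurification ρ)

end QuantumEntropy

end

/-!
Every bound on a smoothed state by `1 ⊗ σ` can be traded for a bound by `1 ⊗ (its own marginal)`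
at the cost of the factor `c` and of a further smoothing by `ε`.

Let `ρ'` be in the `ε'`-ball of `ρ`, with `ρ' ≤ s (1 ⊗ σ)`, and let `ω` be the marginal of `ρ'`
on `B`. Put `X = ω + (ε² / 2) σ`. As `ω ≤ X`, there is a contraction `G` with `√ω = G √X`, hence
with `G X Gᴴ = ω`. Conjugating `ρ'` by `1 ⊗ G` turns the bound by `σ ≤ (2 / ε²) X` into a bound by
`(2 / ε²) ω`, and only lowers the marginal. The missing part `ω - G ω Gᴴ` of the marginal is put
back, tensored with the maximally mixed state of `A`; its bound involves `1 / d_A ≤ s / tr ρ'`, and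
`tr ρ' ≥ 1 - ε'`. The resulting state `τ` has the marginal `ω` and satisfies `τ ≤ s c (1 ⊗ ω)`
(`exists_le_smul_one_kronecker_traceFst`).

The distance from `ρ'` to `τ` is at most `ε`. The two states have equal trace and
`(1 ⊗ G) ρ' (1 ⊗ G)ᴴ ≤ τ`, so that `1 - F` is at most `tr ω (1 - G)` (`re_trace_mul_le_fidelity`),
which is at most `tr X - tr ω = ε² / 2` because the square root is operator monotone
(`exists_mul_mul_conjTranspose_eq`). The triangle inequality for the purified distance
(`purifiedDist_triangle`) then puts `τ` in the `(ε + ε')`-ball of `ρ`. It is the triangle inequality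
for angles in a Hilbert-Schmidt space with one extra dimension, which accounts for the missing
trace.

The facts on fidelities need no unitary polar decomposition: the trace norm is the maximum of
`Re tr (W M)` over contractions `W` (`re_trace_mul_le_trace_abs`, `exists_mul_eq_abs`), and
contractions come from the factorization `exists_eq_mul_of_conjTranspose_mul_self_le`.

Conversely the marginal of `τ`, once normalized, is one of the states `σ` in the definition of
`minEntropy τ`. The inequalities for max-entropies are those for min-entropies of the
`AC`-marginal of the purification, with signs reversed.
-/

namespace QuantumEntropy

/-! ### Contractions and the trace norm -/

section Contractions

-- Contractions are the matrices of operator norm at most `1`.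
open scoped Matrix.Norms.L2Operator

variable {H : Type*} [Fintype H] [DecidableEq H]

theorem norm_le_one_iff_conjTranspose_mul_self_le_one (K : Matrix H H ℂ) :
    ‖K‖ ≤ 1 ↔ Kᴴ * K ≤ 1 := by
  rw [← CStarAlgebra.norm_le_one_iff_of_nonneg (Kᴴ * K) (star_mul_self_nonneg K),
    ← Matrix.star_eq_conjTranspose, CStarRing.norm_star_mul_self, ← sq,
    sq_le_one_iff₀ (norm_nonneg K)]

theorem norm_mul_le_one {K L : Matrix H H ℂ} (hK : ‖K‖ ≤ 1) (hL : ‖L‖ ≤ 1) : ‖K * L‖ ≤ 1 :=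
  (norm_mul_le K L).trans (mul_le_one₀ hK (norm_nonneg L) hL)

theorem norm_conjTranspose_le_one {K : Matrix H H ℂ} (hK : ‖K‖ ≤ 1) : ‖Kᴴ‖ ≤ 1 := by
  rwa [← Matrix.star_eq_conjTranspose, norm_star]

theorem conjTranspose_sqrt (ρ : Matrix H H ℂ) : (CFC.sqrt ρ)ᴴ = CFC.sqrt ρ :=
  (IsSelfAdjoint.of_nonneg (CFC.sqrt_nonneg ρ)).star_eq

omit [DecidableEq H] in
theorem trace_re_nonneg {P : Matrix H H ℂ} (hP : 0 ≤ P) : 0 ≤ P.trace.re :=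
  (Complex.le_def.1 (Matrix.nonneg_iff_posSemidef.1 hP).trace_nonneg).1

omit [DecidableEq H] in
theorem trace_re_mono {P Q : Matrix H H ℂ} (h : P ≤ Q) : P.trace.re ≤ Q.trace.re := by
  have := trace_re_nonneg (sub_nonneg.2 h)
  rw [Matrix.trace_sub, Complex.sub_re] at this
  linarith

/-- A contraction lowers the trace of a positive operator: conjugate the inequality
`K + Kᴴ ≤ 1 + Kᴴ K ≤ 2` by `√P`. -/
theorem re_trace_mul_le_of_norm_le_one {P K : Matrix H H ℂ} (hP : 0 ≤ P) (hK : ‖K‖ ≤ 1) :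
    (P * K).trace.re ≤ P.trace.re := by
  have h1 : K + Kᴴ ≤ 1 + Kᴴ * K := by
    rw [← sub_nonneg]
    convert star_mul_self_nonneg (1 - K) using 1
    simp only [star_sub, star_one, Matrix.star_eq_conjTranspose]
    noncomm_ring
  have h2 : K + Kᴴ ≤ 1 + 1 :=
    h1.trans (by gcongr; exact (norm_le_one_iff_conjTranspose_mul_self_le_one K).1 hK)
  have h3 := trace_re_mono (star_left_conjugate_le_conjugate h2 (CFC.sqrt P))
  rw [Matrix.star_eq_conjTranspose, conjTranspose_sqrt, Matrix.trace_mul_comm, ← mul_assoc,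
    CFC.sqrt_mul_sqrt_self P hP, Matrix.trace_mul_comm (CFC.sqrt P * (1 + 1)), ← mul_assoc,
    CFC.sqrt_mul_sqrt_self P hP] at h3
  have h4 : (P * Kᴴ).trace.re = (P * K).trace.re := by
    have : P * Kᴴ = (K * P)ᴴ := by
      rw [Matrix.conjTranspose_mul, (Matrix.nonneg_iff_posSemidef.1 hP).1]
    rw [this, Matrix.trace_conjTranspose, Matrix.trace_mul_comm]
    simp
  simp only [mul_add, Matrix.trace_add, Complex.add_re, h4, mul_one] at h3
  linarith

/-- Douglas factorization: if `Mᴴ M ≤ P²` then `M = K P` for a contraction `K`, namely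
`M` times the pseudo-inverse of `P`. -/
theorem exists_eq_mul_of_conjTranspose_mul_self_le {M P : Matrix H H ℂ} (hP : 0 ≤ P)
    (h : Mᴴ * M ≤ P * P) : ∃ K : Matrix H H ℂ, ‖K‖ ≤ 1 ∧ M = K * P := by
  have hsa : IsSelfAdjoint P := IsSelfAdjoint.of_nonneg hP
  have hc (f : ℝ → ℝ) : ContinuousOn f (spectrum ℝ P) := Matrix.finite_real_spectrum.continuousOn f
  -- `cfc` of the inversion is the pseudo-inverse, by the convention `0⁻¹ = 0`.
  set R : Matrix H H ℂ := cfc (fun x : ℝ => x⁻¹) P with hR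
  have hRs : star R = R := (cfc_predicate (fun x : ℝ => x⁻¹) P).star_eq
  have hid : cfc (fun x : ℝ => x) P = P := cfc_id' ℝ P
  have hRP : R * P = cfc (fun x : ℝ => x⁻¹ * x) P := by
    conv_lhs => rw [hR]; arg 2; rw [← hid]
    rw [← cfc_mul _ _ P (hc _) (hc _)]
  have hPR : P * R = R * P := by
    conv_lhs => rw [hR]; arg 1; rw [← hid]
    rw [← cfc_mul _ _ P (hc _) (hc _), hRP]
    simp only [mul_comm]
  have hPRP : P * (R * P) = P := by
    conv_lhs => rw [hRP]; arg 1; rw [← hid]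
    rw [← cfc_mul _ _ P (hc _) (hc _)]
    conv_rhs => rw [← hid]
    congr 1; ext x
    rcases eq_or_ne x 0 with rfl | hx
    · simp
    · field_simp
  refine ⟨M * R, ?_, ?_⟩
  · rw [norm_le_one_iff_conjTranspose_mul_self_le_one]
    have h1 := star_left_conjugate_le_conjugate h R
    have h2 : star R * (P * P) * R ≤ 1 := by
      have : star R * (P * P) * R = cfc (fun x : ℝ => (x⁻¹ * x) * (x⁻¹ * x)) P := by
        rw [cfc_mul _ _ P (hc _) (hc _), ← hRP, hRs]
        conv_rhs => arg 2; rw [← hPR]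
        simp only [mul_assoc]
      rw [this]
      refine cfc_le_one _ P fun x _ => ?_
      rcases eq_or_ne x 0 with rfl | hx
      · simp
      · simp [hx]
    refine le_trans (le_of_eq ?_) (h1.trans h2)
    simp only [Matrix.conjTranspose_mul, Matrix.star_eq_conjTranspose, mul_assoc]
  · -- `N = M (1 - R P)` vanishes because `Nᴴ N ≤ (1 - R P)ᴴ P² (1 - R P) = 0`.
    have h0 : P * (1 - R * P) = 0 := by rw [mul_sub, hPRP, mul_one, sub_self]
    have h1 := star_left_conjugate_le_conjugate h (1 - R * P)
    have h2 : star (1 - R * P) * (P * P) * (1 - R * P) = 0 := by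
      rw [mul_assoc, mul_assoc, h0, mul_zero, mul_zero]
    have h3 : (M * (1 - R * P))ᴴ * (M * (1 - R * P)) = 0 := by
      refine le_antisymm ?_ (star_mul_self_nonneg (M * (1 - R * P)))
      rw [← h2]
      refine le_trans (le_of_eq ?_) h1
      simp only [Matrix.conjTranspose_mul, Matrix.star_eq_conjTranspose, mul_assoc]
    have h4 : M * (1 - R * P) = 0 := Matrix.conjTranspose_mul_self_eq_zero.1 h3
    rw [mul_sub, mul_one, sub_eq_zero] at h4
    rw [mul_assoc, ← h4]

theorem exists_polar (M : Matrix H H ℂ) :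
    ∃ K : Matrix H H ℂ, ‖K‖ ≤ 1 ∧ M = K * CFC.abs M :=
  exists_eq_mul_of_conjTranspose_mul_self_le (CFC.abs_nonneg M)
    (le_of_eq (CFC.abs_mul_abs M).symm)

theorem re_trace_mul_le_trace_abs (M : Matrix H H ℂ) {W : Matrix H H ℂ} (hW : ‖W‖ ≤ 1) :
    (W * M).trace.re ≤ (CFC.abs M).trace.re := by
  obtain ⟨K, hK, hM⟩ := exists_polar M
  conv_lhs => rw [hM, ← mul_assoc, Matrix.trace_mul_comm]
  exact re_trace_mul_le_of_norm_le_one (CFC.abs_nonneg M) (norm_mul_le_one hW hK)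

/-- The trace norm is attained. In the polar decomposition `M = K |M|` the positive operator
`1 - Kᴴ K` satisfies `|M| (1 - Kᴴ K) |M| = 0`, so it annihilates `|M|` and `Kᴴ M = |M|`. -/
theorem exists_mul_eq_abs (M : Matrix H H ℂ) :
    ∃ W : Matrix H H ℂ, ‖W‖ ≤ 1 ∧ W * M = CFC.abs M := by
  obtain ⟨K, hK, hM⟩ := exists_polar M
  refine ⟨Kᴴ, norm_conjTranspose_le_one hK, ?_⟩
  set P := CFC.abs M with hP
  have hPs : Pᴴ = P := (Matrix.nonneg_iff_posSemidef.1 (CFC.abs_nonneg M)).1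
  have hQ : 0 ≤ 1 - Kᴴ * K :=
    sub_nonneg.2 ((norm_le_one_iff_conjTranspose_mul_self_le_one K).1 hK)
  have h0 : P * (1 - Kᴴ * K) * P = 0 := by
    have h1 : P * P = Mᴴ * M := CFC.abs_mul_abs M
    rw [hM, Matrix.conjTranspose_mul, hPs] at h1
    rw [mul_sub, sub_mul, mul_one, h1, sub_eq_zero]
    simp only [mul_assoc]
  set S := CFC.sqrt (1 - Kᴴ * K) with hS
  have hSS : S * S = 1 - Kᴴ * K := CFC.sqrt_mul_sqrt_self _ hQ
  have h2 : S * P = 0 := by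
    rw [← Matrix.conjTranspose_mul_self_eq_zero, Matrix.conjTranspose_mul, hPs, hS,
      conjTranspose_sqrt, ← hS, ← h0, ← hSS]
    simp only [mul_assoc]
  have h3 : (1 - Kᴴ * K) * P = 0 := by rw [← hSS, mul_assoc, h2, mul_zero]
  rw [sub_mul, one_mul, sub_eq_zero] at h3
  conv_lhs => rw [hM, ← mul_assoc, ← h3]

end Contractions

/-! ### The generalized fidelity and the triangle inequality for the purified distance -/

section Fidelity

/-- The triangle inequality for angles, stated for their sines. The vectors `a` and `c` may be
shorter than `1`, and `z` may exceed `⟪a, c⟫`; it may even exceed `1`, where the left side is `0`.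
It follows from the Cauchy-Schwarz inequality for the components of `a` and `c` orthogonal
to `b`. -/
theorem sqrt_one_sub_sq_le_add {E : Type*} [NormedAddCommGroup E] [InnerProductSpace ℝ E]
    {a b c : E} (ha : ‖a‖ ≤ 1) (hb : ‖b‖ = 1) (hc : ‖c‖ ≤ 1)
    (hab : 0 ≤ inner ℝ a b) (hbc : 0 ≤ inner ℝ b c) {z : ℝ} (hz : inner ℝ a c ≤ z) :
    √(1 - z ^ 2) ≤ √(1 - inner ℝ a b ^ 2) + √(1 - inner ℝ b c ^ 2) := by
  set x := inner ℝ a b with hx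
  set y := inner ℝ b c with hy
  have hbb : inner ℝ b b = (1 : ℝ) := by rw [real_inner_self_eq_norm_sq, hb, one_pow]
  have hba : inner ℝ b a = x := real_inner_comm _ _
  have hcb : inner ℝ c b = y := real_inner_comm _ _
  have ha' : ‖a - x • b‖ ^ 2 ≤ 1 - x ^ 2 := by
    have : ‖a‖ ^ 2 ≤ 1 := by nlinarith [norm_nonneg a]
    rw [← real_inner_self_eq_norm_sq] at this ⊢
    simp only [inner_sub_left, inner_sub_right, inner_smul_left, inner_smul_right, hbb, hba, ← hx]
    simp only [conj_trivial]
    nlinarith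
  have hc' : ‖c - y • b‖ ^ 2 ≤ 1 - y ^ 2 := by
    have : ‖c‖ ^ 2 ≤ 1 := by nlinarith [norm_nonneg c]
    rw [← real_inner_self_eq_norm_sq] at this ⊢
    simp only [inner_sub_left, inner_sub_right, inner_smul_left, inner_smul_right, hbb, hcb, ← hy]
    simp only [conj_trivial]
    nlinarith
  have hac : inner ℝ (a - x • b) (c - y • b) = inner ℝ a c - x * y := by
    simp only [inner_sub_left, inner_sub_right, inner_smul_left, inner_smul_right, hbb, ← hx, ← hy]
    simp only [conj_trivial]
    ring
  have hlow : x * y - √(1 - x ^ 2) * √(1 - y ^ 2) ≤ z := by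
    have h1 := (abs_le.1 (abs_real_inner_le_norm (a - x • b) (c - y • b))).1
    have h2 : ‖a - x • b‖ * ‖c - y • b‖ ≤ √(1 - x ^ 2) * √(1 - y ^ 2) :=
      mul_le_mul (Real.le_sqrt_of_sq_le ha') (Real.le_sqrt_of_sq_le hc') (norm_nonneg _)
        (Real.sqrt_nonneg _)
    linarith
  set s := √(1 - x ^ 2) with hs
  set t := √(1 - y ^ 2) with ht
  have hs0 : 0 ≤ s := Real.sqrt_nonneg _
  have ht0 : 0 ≤ t := Real.sqrt_nonneg _
  have hss : s ^ 2 = 1 - x ^ 2 := Real.sq_sqrt ((sq_nonneg _).trans ha')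
  have htt : t ^ 2 = 1 - y ^ 2 := Real.sq_sqrt ((sq_nonneg _).trans hc')
  refine Real.sqrt_le_iff.2 ⟨add_nonneg hs0 ht0, ?_⟩
  have hx1 : x ≤ 1 := by nlinarith
  have hy1 : y ≤ 1 := by nlinarith
  rcases le_total (s * t) (x * y) with h | h
  · have h3 : (x * y - s * t) ^ 2 ≤ z ^ 2 := pow_le_pow_left₀ (sub_nonneg.2 h) hlow 2
    -- `1 - (x y - s t)² = (x t + y s)²`
    have h4 : 1 - (x * y - s * t) ^ 2 = (x * t + y * s) ^ 2 := by
      have : (x * y - s * t) ^ 2 + (x * t + y * s) ^ 2 = (x ^ 2 + s ^ 2) * (y ^ 2 + t ^ 2) := by ring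
      rw [hss, htt] at this
      linarith
    have h5 : (x * t + y * s) ^ 2 ≤ (s + t) ^ 2 := by
      refine pow_le_pow_left₀ (by positivity) ?_ 2
      nlinarith
    linarith
  · have h3 : (x * y) ^ 2 ≤ (s * t) ^ 2 := pow_le_pow_left₀ (by positivity) h 2
    have h4 : x ^ 2 * y ^ 2 ≤ (1 - x ^ 2) * (1 - y ^ 2) := by
      rw [← hss, ← htt, ← mul_pow, ← mul_pow]; exact h3
    nlinarith [mul_nonneg hs0 ht0, sq_nonneg z]

open scoped Matrix.Norms.L2Operator

variable {H : Type*} [Fintype H] [DecidableEq H]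

theorem genFidelity_nonneg (ρ τ : Matrix H H ℂ) : 0 ≤ genFidelity ρ τ :=
  add_nonneg (trace_re_nonneg (CFC.abs_nonneg _)) (Real.sqrt_nonneg _)

/-- The operator `M`, seen as a vector of Hilbert-Schmidt space, extended by the extra
coordinate `r`. -/
def hsVec (M : Matrix H H ℂ) (r : ℝ) : EuclideanSpace ℂ ((H × H) ⊕ Unit) :=
  WithLp.toLp 2 (Sum.elim (fun p => M p.1 p.2) fun _ => (r : ℂ))

omit [DecidableEq H] in
theorem inner_hsVec (M N : Matrix H H ℂ) (r s : ℝ) :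
    inner ℝ (hsVec M r) (hsVec N s) = (Mᴴ * N).trace.re + r * s := by
  simp only [hsVec, PiLp.inner_apply, Fintype.sum_sum_type, Matrix.trace, Matrix.diag,
    Matrix.mul_apply, Matrix.conjTranspose_apply, Fintype.sum_prod_type, Complex.re_sum]
  rw [Finset.sum_comm]
  simp [Complex.inner, mul_comm]

theorem norm_hsVec_le_one {ρ K : Matrix H H ℂ} (hρ : IsSubnormalized ρ) (hK : ‖K‖ ≤ 1) :
    ‖hsVec (CFC.sqrt ρ * K) √(1 - ρ.trace.re)‖ ≤ 1 := by
  have h1 : ‖hsVec (CFC.sqrt ρ * K) √(1 - ρ.trace.re)‖ ^ 2 ≤ 1 := by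
    rw [← real_inner_self_eq_norm_sq, inner_hsVec, Real.mul_self_sqrt (by linarith [hρ.2.2]),
      Matrix.conjTranspose_mul, conjTranspose_sqrt, mul_assoc, ← mul_assoc (CFC.sqrt ρ),
      CFC.sqrt_mul_sqrt_self ρ hρ.1.nonneg, Matrix.trace_mul_comm, mul_assoc]
    have := re_trace_mul_le_of_norm_le_one hρ.1.nonneg
      (norm_mul_le_one hK (norm_conjTranspose_le_one hK))
    linarith
  exact (sq_le_one_iff₀ (norm_nonneg _)).1 h1

/-- Triangle inequality. Contractions `K` and `L` attaining the two trace norms turn the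
fidelities of the pairs `ρ, ω` and `ω, τ` into inner products of the vectors
`√ρ Kᴴ`, `√ω`, `√τ L` of the Hilbert-Schmidt space. -/
theorem purifiedDist_triangle {ρ ω τ : Matrix H H ℂ} (hρ : IsSubnormalized ρ)
    (hω : IsSubnormalized ω) (hτ : IsSubnormalized τ) :
    purifiedDist ρ τ ≤ purifiedDist ρ ω + purifiedDist ω τ := by
  obtain ⟨K, hK, hKe⟩ := exists_mul_eq_abs (CFC.sqrt ρ * CFC.sqrt ω)
  obtain ⟨L, hL, hLe⟩ := exists_mul_eq_abs (CFC.sqrt ω * CFC.sqrt τ)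
  set a := hsVec (CFC.sqrt ρ * Kᴴ) √(1 - ρ.trace.re) with ha
  set b := hsVec (CFC.sqrt ω) √(1 - ω.trace.re) with hb
  set c := hsVec (CFC.sqrt τ * L) √(1 - τ.trace.re) with hc
  have hρ1 : 0 ≤ 1 - ρ.trace.re := by linarith [hρ.2.2]
  have hω1 : 0 ≤ 1 - ω.trace.re := by linarith [hω.2.2]
  have hab : inner ℝ a b = genFidelity ρ ω := by
    rw [ha, hb, inner_hsVec, genFidelity, Real.sqrt_mul hρ1, ← hKe, Matrix.conjTranspose_mul,
      conjTranspose_sqrt, Matrix.conjTranspose_conjTranspose, mul_assoc]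
  have hbc : inner ℝ b c = genFidelity ω τ := by
    rw [hb, hc, inner_hsVec, genFidelity, Real.sqrt_mul hω1, ← hLe, conjTranspose_sqrt,
      ← mul_assoc, Matrix.trace_mul_comm]
  have hac : inner ℝ a c ≤ genFidelity ρ τ := by
    rw [ha, hc, inner_hsVec, genFidelity, Real.sqrt_mul hρ1, Matrix.conjTranspose_mul,
      conjTranspose_sqrt, Matrix.conjTranspose_conjTranspose, ← mul_assoc, Matrix.trace_mul_comm]
    have := re_trace_mul_le_trace_abs (CFC.sqrt ρ * CFC.sqrt τ) (norm_mul_le_one hL hK)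
    simpa only [mul_assoc, add_le_add_iff_right] using this
  have hb1 : ‖b‖ = 1 := by
    have h : ‖b‖ ^ 2 = 1 := by
      rw [hb, ← real_inner_self_eq_norm_sq, inner_hsVec, Real.mul_self_sqrt hω1,
        conjTranspose_sqrt, CFC.sqrt_mul_sqrt_self ω hω.1.nonneg]
      ring
    exact (pow_eq_one_iff_of_nonneg (norm_nonneg b) two_ne_zero).1 h
  have h := sqrt_one_sub_sq_le_add
    (norm_hsVec_le_one hρ (norm_conjTranspose_le_one hK)) hb1 (norm_hsVec_le_one hτ hL)
    (hab.symm ▸ genFidelity_nonneg ρ ω) (hbc.symm ▸ genFidelity_nonneg ω τ) hac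
  rwa [← ha, ← hc, hab, hbc] at h

/-- If `G ρ Gᴴ ≤ τ`, factor `√ρ Gᴴ = K √τ` through `√τ` with a contraction `K`; then
`tr (ρ G)` is the trace of `Kᴴ √ρ √τ`. -/
theorem re_trace_mul_le_fidelity {ρ τ G : Matrix H H ℂ} (hρ : 0 ≤ ρ) (hτ : 0 ≤ τ)
    (h : G * ρ * Gᴴ ≤ τ) :
    (ρ * G).trace.re ≤ (CFC.abs (CFC.sqrt ρ * CFC.sqrt τ)).trace.re := by
  obtain ⟨K, hK, hKe⟩ := exists_eq_mul_of_conjTranspose_mul_self_le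
    (M := CFC.sqrt ρ * Gᴴ) (CFC.sqrt_nonneg τ) (by
      rw [CFC.sqrt_mul_sqrt_self τ hτ, Matrix.conjTranspose_mul, conjTranspose_sqrt,
        Matrix.conjTranspose_conjTranspose, mul_assoc, ← mul_assoc (CFC.sqrt ρ),
        CFC.sqrt_mul_sqrt_self ρ hρ, ← mul_assoc]
      exact h)
  have h1 : G * CFC.sqrt ρ = CFC.sqrt τ * Kᴴ := by
    have := congrArg Matrix.conjTranspose hKe
    simpa only [Matrix.conjTranspose_mul, conjTranspose_sqrt,
      Matrix.conjTranspose_conjTranspose] using this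
  have h2 := re_trace_mul_le_trace_abs (CFC.sqrt ρ * CFC.sqrt τ) (norm_conjTranspose_le_one hK)
  rw [Matrix.trace_mul_comm, mul_assoc, ← h1, Matrix.trace_mul_comm, mul_assoc,
    CFC.sqrt_mul_sqrt_self ρ hρ, Matrix.trace_mul_comm] at h2
  exact h2

end Fidelity

/-! ### Partial traces -/

section PartialTrace

variable {A B C : Type*} [Fintype A]

theorem traceFst_add (M N : Matrix (A × B) (A × B) ℂ) :
    traceFst (M + N) = traceFst M + traceFst N := by
  ext; simp [traceFst, Finset.sum_add_distrib]

theorem trace_traceFst [Fintype B] (M : Matrix (A × B) (A × B) ℂ) : (traceFst M).trace = M.trace := by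
  simp [traceFst, Matrix.trace, Fintype.sum_prod_type_right]

theorem traceFst_one_kronecker [DecidableEq A] (σ : Matrix B B ℂ) :
    traceFst ((1 : Matrix A A ℂ) ⊗ₖ σ) = (Fintype.card A : ℝ) • σ := by
  ext; simp [traceFst]

theorem traceFst_nonneg {M : Matrix (A × B) (A × B) ℂ} (hM : 0 ≤ M) : 0 ≤ traceFst M := by
  have h : traceFst M = ∑ a, M.submatrix (fun b => (a, b)) (fun b => (a, b)) := by
    ext; simp [traceFst, Matrix.sum_apply]
  rw [h]
  exact Finset.sum_nonneg fun a _ =>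
    ((Matrix.nonneg_iff_posSemidef.1 hM).submatrix _).nonneg

theorem traceFst_mul_one_kronecker [Fintype B] [DecidableEq A]
    (M : Matrix (A × B) (A × B) ℂ) (G : Matrix B B ℂ) :
    traceFst (M * (1 : Matrix A A ℂ) ⊗ₖ G) = traceFst M * G := by
  ext b b'
  simp only [traceFst, Matrix.of_apply, Matrix.mul_apply, Fintype.sum_prod_type_right,
    Matrix.kroneckerMap_apply, Matrix.one_apply, Finset.sum_mul]
  rw [Finset.sum_comm]
  simp

theorem traceFst_one_kronecker_mul [Fintype B] [DecidableEq A]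
    (M : Matrix (A × B) (A × B) ℂ) (G : Matrix B B ℂ) :
    traceFst ((1 : Matrix A A ℂ) ⊗ₖ G * M) = G * traceFst M := by
  ext b b'
  simp only [traceFst, Matrix.of_apply, Matrix.mul_apply, Fintype.sum_prod_type_right,
    Matrix.kroneckerMap_apply, Matrix.one_apply, Finset.mul_sum]
  rw [Finset.sum_comm]
  simp

theorem one_kronecker_mono [Fintype B] [DecidableEq A] {σ τ : Matrix B B ℂ} (h : σ ≤ τ) :
    (1 : Matrix A A ℂ) ⊗ₖ σ ≤ (1 : Matrix A A ℂ) ⊗ₖ τ := by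
  have := (Matrix.PosSemidef.one (n := A) (R := ℂ)).kronecker
    (Matrix.nonneg_iff_posSemidef.1 (sub_nonneg.2 h))
  rw [← sub_nonneg]
  refine le_of_le_of_eq this.nonneg ?_
  ext ⟨a, b⟩ ⟨a', b'⟩
  simp [mul_sub]

theorem traceMid_proj_isNormalized [Fintype B] [Fintype C] {ρ : Matrix (A × B) (A × B) ℂ}
    (hρ : IsNormalized ρ)
    {ψ : (A × B) × C → ℂ} (hψ : IsPurification ψ ρ) :
    IsNormalized (traceMid (proj ψ)) := by
  have hp : (proj ψ).PosSemidef := Matrix.posSemidef_vecMulVec_self_star ψ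
  constructor
  · have h : traceMid (proj ψ) =
        ∑ b, (proj ψ).submatrix (fun x : A × C => ((x.1, b), x.2)) (fun x => ((x.1, b), x.2)) := by
      ext; simp [traceMid, Matrix.sum_apply]
    rw [h]
    exact Matrix.posSemidef_sum _ fun b _ => hp.submatrix _
  · rw [← hρ.2, ← hψ]
    simp only [traceMid, traceSnd, Matrix.trace, Matrix.diag, Matrix.of_apply,
      Fintype.sum_prod_type]
    exact Finset.sum_congr rfl fun a _ => Finset.sum_comm

end PartialTrace

/-! ### Smoothing towards the marginal -/

section Smoothing

open scoped Matrix.Norms.L2Operator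

variable {A B H : Type*} [Fintype A] [Fintype B] [Fintype H] [DecidableEq A] [DecidableEq B]
  [DecidableEq H]

/-- If `ρ ≤ X`, the factorization `√ρ = G √X` gives a contraction `G` carrying `X` to `ρ`.
It is close to the identity on `ρ`: as `1 - G` has non-negative real part, `tr ρ (1 - G)` is at
most `tr X (1 - G) = tr X - tr √X √ρ`, and `√ρ ≤ √X` by operator monotonicity. -/
theorem exists_mul_mul_conjTranspose_eq {ρ X : Matrix H H ℂ} (hρ : 0 ≤ ρ) (h : ρ ≤ X) :
    ∃ G : Matrix H H ℂ, G * X * Gᴴ = ρ ∧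
      ρ.trace.re - (ρ * G).trace.re ≤ X.trace.re - ρ.trace.re := by
  have hX : 0 ≤ X := hρ.trans h
  obtain ⟨G, hG, hGe⟩ := exists_eq_mul_of_conjTranspose_mul_self_le
    (M := CFC.sqrt ρ) (CFC.sqrt_nonneg X) (by
      rw [conjTranspose_sqrt, CFC.sqrt_mul_sqrt_self ρ hρ, CFC.sqrt_mul_sqrt_self X hX]
      exact h)
  refine ⟨G, ?_, ?_⟩
  · have h1 : (G * CFC.sqrt X) * (G * CFC.sqrt X)ᴴ = ρ := by
      rw [← hGe, conjTranspose_sqrt, CFC.sqrt_mul_sqrt_self ρ hρ]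
    rw [← h1, Matrix.conjTranspose_mul, conjTranspose_sqrt, mul_assoc, mul_assoc,
      ← mul_assoc (CFC.sqrt X), CFC.sqrt_mul_sqrt_self X hX]
  · have h1 := re_trace_mul_le_of_norm_le_one (sub_nonneg.2 h) hG
    have h2 : (X * G).trace = (CFC.sqrt X * CFC.sqrt ρ).trace := by
      conv_lhs => rw [← CFC.sqrt_mul_sqrt_self X hX]
      rw [mul_assoc, Matrix.trace_mul_comm, mul_assoc, ← hGe]
    -- `tr ρ ≤ tr √X √ρ`: conjugate `√ρ ≤ √X` by the square root of `√ρ`.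
    have h3 : ρ.trace.re ≤ (CFC.sqrt X * CFC.sqrt ρ).trace.re := by
      set Q := CFC.sqrt (CFC.sqrt ρ) with hQ
      have hQQ : Q * Q = CFC.sqrt ρ := CFC.sqrt_mul_sqrt_self _ (CFC.sqrt_nonneg ρ)
      have h4 := trace_re_mono
        (star_left_conjugate_le_conjugate (CFC.sqrt_le_sqrt ρ X h) Q)
      rw [Matrix.star_eq_conjTranspose, hQ, conjTranspose_sqrt, ← hQ, mul_assoc,
        Matrix.trace_mul_comm, mul_assoc, hQQ, CFC.sqrt_mul_sqrt_self ρ hρ, mul_assoc,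
        Matrix.trace_mul_comm, mul_assoc, hQQ] at h4
      exact h4
    rw [sub_mul, Matrix.trace_sub, Matrix.trace_sub, Complex.sub_re, Complex.sub_re, h2] at h1
    linarith

/-- For states of equal trace `1 - F` is at most `tr ρ (1 - G)`, and `1 - F² ≤ 2 (1 - F)`. -/
theorem purifiedDist_le_of_trace_eq {ρ τ G : Matrix H H ℂ} {ε : ℝ} (hε : 0 ≤ ε)
    (hρ : IsSubnormalized ρ) (hτ : 0 ≤ τ) (ht : τ.trace = ρ.trace) (h : G * ρ * Gᴴ ≤ τ)
    (hG : ρ.trace.re - (ρ * G).trace.re ≤ ε ^ 2 / 2) : purifiedDist ρ τ ≤ ε := by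
  have h1 := re_trace_mul_le_fidelity hρ.1.nonneg hτ h
  have h2 : 1 - genFidelity ρ τ ≤ ε ^ 2 / 2 := by
    rw [genFidelity, ht, Real.sqrt_mul_self (by linarith [hρ.2.2])]
    linarith
  refine Real.sqrt_le_iff.2 ⟨hε, ?_⟩
  nlinarith [sq_nonneg (1 - genFidelity ρ τ)]

/-- The smoothing step. With `X = ρ_B + (ε² / 2) σ` and `G X Gᴴ = ρ_B`, the state is
`(1 ⊗ G) ρ (1 ⊗ G)ᴴ + d_A⁻¹ 1 ⊗ (ρ_B - G ρ_B Gᴴ)`. Its marginal is `ρ_B`; the first summand is at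
most `s (2 / ε²) 1 ⊗ ρ_B` because `σ ≤ (2 / ε²) X`, the second at most `(s / tr ρ) 1 ⊗ ρ_B`
because `tr ρ ≤ s d_A`. -/
theorem exists_le_smul_one_kronecker_traceFst {ρ : Matrix (A × B) (A × B) ℂ}
    (hρ : IsSubnormalized ρ) {σ : Matrix B B ℂ} (hσ : IsNormalized σ) {s ε : ℝ} (hs : 0 < s)
    (hε : 0 < ε) (h : ρ ≤ s • ((1 : Matrix A A ℂ) ⊗ₖ σ)) :
    ∃ τ : Matrix (A × B) (A × B) ℂ, IsSubnormalized τ ∧ purifiedDist ρ τ ≤ ε ∧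
      τ ≤ (s * (2 / ε ^ 2 + 1 / ρ.trace.re)) • ((1 : Matrix A A ℂ) ⊗ₖ traceFst τ) := by
  set κ : ℝ := ε ^ 2 / 2 with hκ
  have hκ0 : 0 < κ := by positivity
  set ω := traceFst ρ with hω
  have hω0 : 0 ≤ ω := traceFst_nonneg hρ.1.nonneg
  have hωX : ω ≤ ω + κ • σ := le_add_of_nonneg_right (smul_nonneg hκ0.le hσ.1.nonneg)
  obtain ⟨G, hGX, hGt⟩ := exists_mul_mul_conjTranspose_eq hω0 hωX
  set d : ℝ := (Fintype.card A : ℝ) with hd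
  -- Taking traces in the hypothesis gives `tr ρ ≤ s d`.
  have htr : ρ.trace.re ≤ s * d := by
    have := trace_re_mono h
    rw [Matrix.trace_smul, Matrix.trace_kronecker, hσ.2] at this
    simpa using this
  -- In particular `A` is not the empty type.
  have hd0 : 0 < d := by
    by_contra hneg
    nlinarith [hρ.2.1]
  set Γ : Matrix (A × B) (A × B) ℂ := 1 ⊗ₖ G with hΓ
  have hΓH : Γᴴ = 1 ⊗ₖ Gᴴ := by
    rw [hΓ, Matrix.conjTranspose_kronecker, Matrix.conjTranspose_one]
  set ω' := G * ω * Gᴴ with hω'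
  have hω'0 : 0 ≤ ω' := star_right_conjugate_nonneg hω0 G
  have hω'ω : ω' ≤ ω := by
    conv_rhs => rw [← hGX]
    exact star_right_conjugate_le_conjugate hωX G
  have hfst : traceFst (Γ * ρ * Γᴴ) = ω' := by
    rw [hΓH, traceFst_mul_one_kronecker, hΓ, traceFst_one_kronecker_mul]
  set τ := Γ * ρ * Γᴴ + d⁻¹ • ((1 : Matrix A A ℂ) ⊗ₖ (ω - ω')) with hτ
  have hrest : 0 ≤ d⁻¹ • ((1 : Matrix A A ℂ) ⊗ₖ (ω - ω')) :=
    smul_nonneg (inv_nonneg.2 hd0.le) (Matrix.PosSemidef.one.kronecker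
      (Matrix.nonneg_iff_posSemidef.1 (sub_nonneg.2 hω'ω))).nonneg
  have hΓρτ : Γ * ρ * Γᴴ ≤ τ := le_add_of_nonneg_right hrest
  have hτ0 : 0 ≤ τ := (star_right_conjugate_nonneg hρ.1.nonneg Γ).trans hΓρτ
  have hτfst : traceFst τ = ω := by
    rw [hτ, traceFst_add, hfst, ← Matrix.kronecker_smul, traceFst_one_kronecker, smul_smul,
      mul_inv_cancel₀ hd0.ne', one_smul, add_sub_cancel]
  have hτtr : τ.trace = ρ.trace := by rw [← trace_traceFst, hτfst, hω, trace_traceFst]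
  refine ⟨τ, ⟨Matrix.nonneg_iff_posSemidef.1 hτ0, by rw [hτtr]; exact hρ.2.1,
    by rw [hτtr]; exact hρ.2.2⟩, ?_, ?_⟩
  · refine purifiedDist_le_of_trace_eq hε.le hρ hτ0 hτtr hΓρτ ?_
    have h1 : (ρ * Γ).trace = (ω * G).trace := by
      rw [← trace_traceFst, hΓ, traceFst_mul_one_kronecker]
    rw [h1, ← trace_traceFst, ← hω]
    refine hGt.trans ?_
    rw [Matrix.trace_add, Matrix.trace_smul, hσ.2, ← hκ]
    simp
  · rw [hτfst]
    have h1 : Γ * ρ * Γᴴ ≤ (s * (2 / ε ^ 2)) • ((1 : Matrix A A ℂ) ⊗ₖ ω) := by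
      have h2 : σ ≤ κ⁻¹ • (ω + κ • σ) := by
        rw [smul_add, smul_smul, inv_mul_cancel₀ hκ0.ne', one_smul]
        exact le_add_of_nonneg_left (smul_nonneg (inv_nonneg.2 hκ0.le) hω0)
      have h3 : G * σ * Gᴴ ≤ κ⁻¹ • ω := by
        refine (star_right_conjugate_le_conjugate h2 G).trans (le_of_eq ?_)
        rw [mul_smul_comm, smul_mul_assoc, Matrix.star_eq_conjTranspose, hGX]
      have h4 : Γ * ρ * Γᴴ ≤ s • ((1 : Matrix A A ℂ) ⊗ₖ (G * σ * Gᴴ)) := by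
        refine (star_right_conjugate_le_conjugate h Γ).trans (le_of_eq ?_)
        rw [Matrix.star_eq_conjTranspose, hΓH, mul_smul_comm, smul_mul_assoc, hΓ,
          ← Matrix.mul_kronecker_mul, ← Matrix.mul_kronecker_mul, one_mul, one_mul]
      refine h4.trans ((smul_le_smul_of_nonneg_left (one_kronecker_mono (A := A) h3) hs.le).trans
        (le_of_eq ?_))
      rw [Matrix.kronecker_smul, smul_smul, hκ, inv_div]
    have h2 : d⁻¹ • ((1 : Matrix A A ℂ) ⊗ₖ (ω - ω')) ≤
        (s * (1 / ρ.trace.re)) • ((1 : Matrix A A ℂ) ⊗ₖ ω) := by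
      have h3 : (1 : Matrix A A ℂ) ⊗ₖ (ω - ω') ≤ (1 : Matrix A A ℂ) ⊗ₖ ω :=
        one_kronecker_mono (sub_le_self _ hω'0)
      have h4 : d⁻¹ ≤ s * (1 / ρ.trace.re) := by
        rw [mul_one_div, inv_le_comm₀ hd0 (div_pos hs hρ.2.1), inv_div, div_le_iff₀ hs, mul_comm]
        exact htr
      exact (smul_le_smul_of_nonneg_left h3 (inv_nonneg.2 hd0.le)).trans
        (smul_le_smul_of_nonneg_right h4 (Matrix.PosSemidef.one.kronecker
          (Matrix.nonneg_iff_posSemidef.1 hω0)).nonneg)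
    rw [mul_add, add_smul]
    exact add_le_add h1 h2

end Smoothing

/-! ### Comparison of the entropies -/

section Entropies

open scoped Matrix.Norms.L2Operator

variable {A B H : Type*} [Fintype A] [Fintype B] [Fintype H] [DecidableEq A] [DecidableEq B]
  [DecidableEq H]

omit [DecidableEq H] in
theorem IsNormalized.isSubnormalized {ρ : Matrix H H ℂ} (hρ : IsNormalized ρ) :
    IsSubnormalized ρ := by
  refine ⟨hρ.1, ?_, ?_⟩ <;> simp [hρ.2]

/-- For normalized `ρ` the generalized fidelity is `tr |√ρ √τ| ≤ √(tr τ)` by Cauchy-Schwarz, so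
states close to `ρ` have trace close to `1`. -/
theorem one_sub_le_trace_of_mem_epsBall {ρ τ : Matrix H H ℂ} (hρ : IsNormalized ρ) {ε : ℝ}
    (hε : 0 ≤ ε) (hε1 : ε < 1) (h : τ ∈ epsBall ε ρ) : 1 - ε ≤ τ.trace.re := by
  obtain ⟨hτ, hd⟩ := h
  have hF : genFidelity ρ τ ^ 2 ≤ τ.trace.re := by
    obtain ⟨K, hK, hKe⟩ := exists_mul_eq_abs (CFC.sqrt ρ * CFC.sqrt τ)
    have h1 : genFidelity ρ τ =
        inner ℝ (hsVec (CFC.sqrt ρ * Kᴴ) √(1 - ρ.trace.re)) (hsVec (CFC.sqrt τ) 0) := by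
      rw [inner_hsVec, genFidelity, ← hKe, Matrix.conjTranspose_mul, conjTranspose_sqrt,
        Matrix.conjTranspose_conjTranspose, mul_assoc, hρ.2]
      simp
    have h2 : ‖hsVec (CFC.sqrt τ) 0‖ ^ 2 = τ.trace.re := by
      rw [← real_inner_self_eq_norm_sq, inner_hsVec, conjTranspose_sqrt,
        CFC.sqrt_mul_sqrt_self τ hτ.1.nonneg]
      simp
    have h3 := norm_hsVec_le_one hρ.isSubnormalized (norm_conjTranspose_le_one hK)
    have h4 := real_inner_le_norm (hsVec (CFC.sqrt ρ * Kᴴ) √(1 - ρ.trace.re)) (hsVec (CFC.sqrt τ) 0)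
    rw [← h2]
    refine pow_le_pow_left₀ (genFidelity_nonneg ρ τ) ?_ 2
    rw [h1]
    exact h4.trans (mul_le_of_le_one_left (norm_nonneg _) h3)
  have h1 := (Real.sqrt_le_iff.1 hd).2
  nlinarith

theorem altMinEntropy_le_minEntropy {τ : Matrix (A × B) (A × B) ℂ} (hτ : IsSubnormalized τ) :
    altMinEntropy τ ≤ minEntropy τ := by
  set t := τ.trace.re with ht
  have ht0 : 0 < t := hτ.2.1
  have htc : τ.trace = (t : ℂ) := by
    apply Complex.ext
    · simp [ht]
    · simpa using (Complex.le_def.1 hτ.1.trace_nonneg).2.symm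
  have hω : 0 ≤ traceFst τ := traceFst_nonneg hτ.1.nonneg
  have hσ : IsNormalized (t⁻¹ • traceFst τ) := by
    refine ⟨Matrix.nonneg_iff_posSemidef.1 (smul_nonneg (inv_nonneg.2 ht0.le) hω), ?_⟩
    rw [Matrix.trace_smul, trace_traceFst, htc, Complex.real_smul, ← Complex.ofReal_mul,
      inv_mul_cancel₀ ht0.ne', Complex.ofReal_one]
  refine le_trans ?_ (le_iSup₂ (f := fun (σ : Matrix B B ℂ) (_ : σ ∈ {σ | IsNormalized σ}) =>
    -Dmax τ ((1 : Matrix A A ℂ) ⊗ₖ σ)) _ hσ)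
  refine EReal.neg_le_neg_iff.2 (sInf_le_sInf (Set.image_mono fun l hl => ?_))
  -- `τ_B ≤ (tr τ)⁻¹ τ_B`, as `tr τ ≤ 1`.
  refine le_trans (Set.mem_ofPred.1 hl) (smul_le_smul_of_nonneg_left (one_kronecker_mono ?_)
    (Real.rpow_nonneg zero_le_two l))
  have h1 : (1 : ℝ) ≤ t⁻¹ := (one_le_inv₀ ht0).2 hτ.2.2
  simpa using smul_le_smul_of_nonneg_right h1 hω

theorem altSmoothMinEntropy_le_smoothMinEntropy (ε : ℝ) (ρ : Matrix (A × B) (A × B) ℂ) :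
    altSmoothMinEntropy ε ρ ≤ smoothMinEntropy ε ρ :=
  iSup₂_mono fun _ hτ => altMinEntropy_le_minEntropy hτ.1

omit [Fintype B] [DecidableEq B] in
theorem neg_coe_le_altMinEntropy {τ : Matrix (A × B) (A × B) ℂ} {l : ℝ}
    (h : τ ≤ ((2 : ℝ) ^ l) • ((1 : Matrix A A ℂ) ⊗ₖ traceFst τ)) :
    -(l : EReal) ≤ altMinEntropy τ :=
  EReal.neg_le_neg_iff.2 (sInf_le ⟨l, h, rfl⟩)

theorem smoothMinEntropy_sub_logb_le {ε ε' : ℝ} (hε : 0 < ε) (hε' : 0 ≤ ε') (hε'1 : ε' < 1)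
    {ρ : Matrix (A × B) (A × B) ℂ} (hρ : IsNormalized ρ) :
    smoothMinEntropy ε' ρ - (Real.logb 2 (2 / ε ^ 2 + 1 / (1 - ε')) : ℝ) ≤
      altSmoothMinEntropy (ε + ε') ρ := by
  set c := 2 / ε ^ 2 + 1 / (1 - ε') with hc
  have hε'2 : 0 < 1 - ε' := sub_pos.2 hε'1
  have hc0 : 0 < c := by positivity
  rw [EReal.sub_le_iff_le_add (Or.inl (EReal.coe_ne_bot _)) (Or.inl (EReal.coe_ne_top _))]
  refine iSup₂_le fun ρ' hρ' => iSup₂_le fun σ hσ => ?_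
  refine EReal.neg_le.1 (le_sInf ?_)
  rintro _ ⟨l, hl, rfl⟩
  obtain ⟨τ, hτ, hd, hle⟩ := exists_le_smul_one_kronecker_traceFst hρ'.1 hσ
    (Real.rpow_pos_of_pos two_pos l) hε hl
  have hmem : τ ∈ epsBall (ε + ε') ρ := by
    refine ⟨hτ, (purifiedDist_triangle hρ.isSubnormalized hρ'.1 hτ).trans ?_⟩
    linarith [hρ'.2]
  have hpow : (2 : ℝ) ^ (l + Real.logb 2 c) = 2 ^ l * c := by
    rw [Real.rpow_add two_pos, Real.rpow_logb two_pos (by norm_num) hc0]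
  have h1 : -((l + Real.logb 2 c : ℝ) : EReal) ≤ altSmoothMinEntropy (ε + ε') ρ := by
    refine (neg_coe_le_altMinEntropy ?_).trans (le_iSup₂ (f := fun τ _ => altMinEntropy τ) τ hmem)
    refine hle.trans (smul_le_smul_of_nonneg_right ?_ ?_)
    · rw [hpow, hc]
      have := hρ'.1.2.1
      gcongr
      exact one_sub_le_trace_of_mem_epsBall hρ hε' hε'1 hρ'
    · exact (Matrix.PosSemidef.one.kronecker
        (Matrix.nonneg_iff_posSemidef.1 (traceFst_nonneg hτ.1.nonneg))).nonneg
  rw [EReal.neg_le]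
  have h2 := add_le_add_left h1 ((Real.logb 2 c : ℝ) : EReal)
  refine le_trans (le_of_eq ?_) h2
  rw [← EReal.coe_neg, ← EReal.coe_neg, ← EReal.coe_add]
  congr 1; ring

omit [DecidableEq B] in
theorem altSmoothMaxEntropyOf_bounds {C : Type*} [Fintype C] [DecidableEq C] {ε ε' : ℝ}
    (hε : 0 < ε) (hε' : 0 ≤ ε') (hε'1 : ε' < 1) {ρ : Matrix (A × B) (A × B) ℂ}
    (hρ : IsNormalized ρ) {ψ : (A × B) × C → ℂ} (hψ : IsPurification ψ ρ) :
    altSmoothMaxEntropyOf (ε + ε') ψ ≤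
        smoothMaxEntropyOf ε' ψ + (Real.logb 2 (2 / ε ^ 2 + 1 / (1 - ε')) : ℝ) ∧
      smoothMaxEntropyOf (ε + ε') ψ ≤ altSmoothMaxEntropyOf (ε + ε') ψ := by
  refine ⟨?_, EReal.neg_le_neg_iff.2 (altSmoothMinEntropy_le_smoothMinEntropy _ _)⟩
  rw [smoothMaxEntropyOf, ← EReal.neg_sub (Or.inr (EReal.coe_ne_bot _))
    (Or.inr (EReal.coe_ne_top _))]
  exact EReal.neg_le_neg_iff.2
    (smoothMinEntropy_sub_logb_le hε hε' hε'1 (traceMid_proj_isNormalized hρ hψ))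

end Entropies

end QuantumEntropy

theorem mainTheorem7 {A B : Type*} [Fintype A] [Fintype B] [DecidableEq A] [DecidableEq B]
    (ε ε' : ℝ) (hε : 0 < ε) (hε' : 0 ≤ ε') (hε'1 : ε' < 1)
    (ρ : Matrix (A × B) (A × B) ℂ) (hρ : QuantumEntropy.IsNormalized ρ)
    (c : ℝ) (hc : c = 2 / ε ^ 2 + 1 / (1 - ε')) :
    (QuantumEntropy.smoothMinEntropy ε' ρ - ((Real.logb 2 c : ℝ) : EReal)
        ≤ QuantumEntropy.altSmoothMinEntropy (ε + ε') ρ ∧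
      QuantumEntropy.altSmoothMinEntropy (ε + ε') ρ
        ≤ QuantumEntropy.smoothMinEntropy (ε + ε') ρ) ∧
    (QuantumEntropy.altSmoothMaxEntropy (ε + ε') ρ
        ≤ QuantumEntropy.smoothMaxEntropy ε' ρ + ((Real.logb 2 c : ℝ) : EReal) ∧
      QuantumEntropy.smoothMaxEntropy (ε + ε') ρ
        ≤ QuantumEntropy.altSmoothMaxEntropy (ε + ε') ρ) ∧
    (∀ (C : Type*) [Fintype C] [DecidableEq C] (ψ : (A × B) × C → ℂ),
      QuantumEntropy.IsPurification ψ ρ →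
      QuantumEntropy.altSmoothMaxEntropyOf (ε + ε') ψ
          ≤ QuantumEntropy.smoothMaxEntropyOf ε' ψ + ((Real.logb 2 c : ℝ) : EReal) ∧
        QuantumEntropy.smoothMaxEntropyOf (ε + ε') ψ
          ≤ QuantumEntropy.altSmoothMaxEntropyOf (ε + ε') ψ) := by
  subst hc
  exact ⟨⟨QuantumEntropy.smoothMinEntropy_sub_logb_le hε hε' hε'1 hρ,
      QuantumEntropy.altSmoothMinEntropy_le_smoothMinEntropy _ _⟩,
    QuantumEntropy.altSmoothMaxEntropyOf_bounds hε hε' hε'1 hρ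
      (QuantumEntropy.stdPurification_isPurification hρ.1),
    fun _ _ _ _ hψ => QuantumEntropy.altSmoothMaxEntropyOf_bounds hε hε' hε'1 hρ hψ⟩
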